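/- A $3$-tournament $T$ on a finite vertex set $V$ is the complete $3$-uniform hypergraph on $V$ in which every edge (every $3$-element subset of $V$) has one of its three vertices designated as its tail. A set $X\subseteq V$ dominates $T$ if every vertex $v\in V\setminus X$ lies in an edge whose tail belongs to $X$; the domination number of $T$ is the minimum size of a dominating set. For every natural number $k$ there is a (finite) $3$-tournament $T$ with domination number greater than $k$ such that every set of four vertices of $T$ contains at least two distinct edges of $T$ with the same tail. Consequently the following first conjecture of Gyárfás is true and the second is false: (1) there are $3$-tournaments with arbitrarily large domination number; (2) there is a constant $C$ such that every $3$-tournament, any four of whose vertices induce at least two edges with the same tail, has domination number at most $C$. -/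

import Mathlib

/-- An `r`-tournament on the vertex set `V`: the complete `r`-uniform hypergraph on `V`,
in which every edge has a designated vertex of that edge, its tail. -/
structure RTournament (r : ℕ) (V : Type) where
  /-- The tail of an edge, an edge being any set of exactly `r` vertices. -/
  tail : {A : Finset V // A.card = r} → V
  tail_mem : ∀ A : {A : Finset V // A.card = r}, tail A ∈ A.1

/-- A `3`-tournament. -/
abbrev ThreeTournament (V : Type) : Type := RTournament 3 V

namespace RTournament

/-- `X` dominates `T` if every vertex outside `X` lies in an edge whose tail is in `X`. -/
def Dominates {r : ℕ} {V : Type} (T : RTournament r V) (X : Finset V) : Prop :=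
  ∀ v : V, v ∉ X → ∃ A : {A : Finset V // A.card = r}, v ∈ A.1 ∧ T.tail A ∈ X

/-- The set of all vertices dominates, so the minimum below is over a non-empty set. -/
theorem dominates_univ {r : ℕ} {V : Type} [Fintype V] (T : RTournament r V) :
    T.Dominates Finset.univ :=
  fun v hv => absurd (Finset.mem_univ v) hv

/-- The domination number: the minimum size of a dominating set. -/
noncomputable def dominationNumber {r : ℕ} {V : Type} [Fintype V] (T : RTournament r V) : ℕ :=
  sInf {m : ℕ | ∃ X : Finset V, T.Dominates X ∧ X.card = m}

end RTournament

/-- Any four vertices induce at least two (distinct) edges with the same tail. -/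
def FourVerticesShareTail {V : Type} (T : ThreeTournament V) : Prop :=
  ∀ S : Finset V, S.card = 4 →
    ∃ A B : {A : Finset V // A.card = 3},
      A ≠ B ∧ A.1 ⊆ S ∧ B.1 ⊆ S ∧ T.tail A = T.tail B

/-- First conjecture of Gyárfás: there are (finite) `3`-tournaments with arbitrarily large
domination number. -/
def GyarfasFirstConjecture : Prop :=
  ∀ k : ℕ, ∃ (V : Type) (_ : Fintype V) (T : ThreeTournament V), k ≤ T.dominationNumber

/-- Second conjecture of Gyárfás: the domination number of a (finite) `3`-tournament any four of
whose vertices induce at least two edges with the same tail is bounded by a constant. -/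
def GyarfasSecondConjecture : Prop :=
  ∃ C : ℕ, ∀ (V : Type) (_ : Fintype V) (T : ThreeTournament V),
    FourVerticesShareTail T → T.dominationNumber ≤ C

/-! Take a finite digraph with no closed walks of length at most four in which any `k` vertices have
a common in-neighbour. Let the tail of each triple be a source of the triple, chosen with an
out-neighbour if the triple spans an arc. If `v` is a common in-neighbour of `X`, no triple
containing `v` has its tail in `X`, so `X` does not dominate. The absence of short cycles gives
sources and two equal tails in any four vertices. `WalkType` provides the digraph. -/

/-- A relation without closed directed walks of length at most four. -/
structure NoShortCycles {V : Type} (E : V → V → Prop) : Prop where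
  one : ∀ a, ¬ E a a
  two : ∀ a b, E a b → ¬ E b a
  three : ∀ a b c, E a b → E b c → ¬ E c a
  four : ∀ a b c d, E a b → E b c → E c d → ¬ E d a

/-- A set of at most four vertices spanning an edge has a source with an out-neighbour. -/
theorem NoShortCycles.exists_source {V : Type} {E : V → V → Prop} (hE : NoShortCycles E)
    (S : Finset V) (hS : S.card ≤ 4) (h : ∃ a ∈ S, ∃ b ∈ S, E a b) :
    ∃ s ∈ S, (∀ y ∈ S, ¬ E y s) ∧ ∃ x ∈ S, E s x := by
  classical
  by_contra! hno
  have step : ∀ a ∈ S, (∃ b ∈ S, E a b) → ∃ y ∈ S, E y a := by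
    intro a ha ⟨b, hb, hab⟩
    by_contra! hn
    exact hno a ha hn b hb hab
  -- Stepping backwards gives a walk `e → d → c → a → b` in `S`; a repeated vertex would close a
  -- walk of length at most four.
  obtain ⟨a, ha, b, hb, hab⟩ := h
  obtain ⟨c, hc, hca⟩ := step a ha ⟨b, hb, hab⟩
  obtain ⟨d, hd, hdc⟩ := step c hc ⟨a, ha, hca⟩
  obtain ⟨e, he, hed⟩ := step d hd ⟨c, hc, hdc⟩
  have hone := hE.one
  have htwo := hE.two
  have hthree := hE.three
  have hfour := hE.four
  have hcard : ({a, b, c, d, e} : Finset V).card = 5 := by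
    have h1 : a ∉ ({b, c, d, e} : Finset V) := by
      simp only [Finset.mem_insert, Finset.mem_singleton]; grind
    have h2 : b ∉ ({c, d, e} : Finset V) := by
      simp only [Finset.mem_insert, Finset.mem_singleton]; grind
    have h3 : c ∉ ({d, e} : Finset V) := by
      simp only [Finset.mem_insert, Finset.mem_singleton]; grind
    have h4 : d ∉ ({e} : Finset V) := by
      simp only [Finset.mem_singleton]; grind
    rw [Finset.card_insert_of_notMem h1, Finset.card_insert_of_notMem h2,
      Finset.card_insert_of_notMem h3, Finset.card_insert_of_notMem h4, Finset.card_singleton]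
  have hsub : ({a, b, c, d, e} : Finset V) ⊆ S := by
    intro x hx
    simp only [Finset.mem_insert, Finset.mem_singleton] at hx
    rcases hx with rfl | rfl | rfl | rfl | rfl <;> assumption
  have := Finset.card_le_card hsub
  omega

/-- `t` is a source of `A`, it has an out-neighbour if `A` spans an edge, and it has the least
rank if `A` spans no edge. -/
def IsTailOf {V : Type} (E : V → V → Prop) (rank : V → ℕ) (A : Finset V) (t : V) : Prop :=
  t ∈ A ∧ (∀ y ∈ A, ¬ E y t) ∧ ((∃ a ∈ A, ∃ b ∈ A, E a b) → ∃ y ∈ A, E t y) ∧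
    ((∀ a ∈ A, ∀ b ∈ A, ¬ E a b) → ∀ y ∈ A, rank t ≤ rank y)

theorem NoShortCycles.exists_isTailOf {V : Type} {E : V → V → Prop} (hE : NoShortCycles E)
    (rank : V → ℕ) (A : Finset V) (hA : A.card = 3) : ∃ t, IsTailOf E rank A t := by
  by_cases h : ∃ a ∈ A, ∃ b ∈ A, E a b
  · obtain ⟨s, hs, hsrc, hout⟩ := hE.exists_source A (by omega) h
    refine ⟨s, hs, hsrc, fun _ => hout, fun hn => ?_⟩
    obtain ⟨a, ha, b, hb, hab⟩ := h
    exact absurd hab (hn a ha b hb)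
  · obtain ⟨t, ht, hmin⟩ := A.exists_min_image rank (Finset.card_pos.mp (by omega))
    exact ⟨t, ht, fun y hy hyt => h ⟨y, hy, t, ht, hyt⟩, fun h' => absurd h' h,
      fun _ => hmin⟩

/-- Tails chosen by `IsTailOf` coincide on two of the edges spanned by any four vertices. -/
theorem fourVerticesShareTail_of_isTailOf {V : Type} {E : V → V → Prop} (hE : NoShortCycles E)
    {rank : V → ℕ} (hrank : Function.Injective rank) (T : ThreeTournament V)
    (hT : ∀ A, IsTailOf E rank A.1 (T.tail A)) : FourVerticesShareTail T := by
  classical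
  intro S hS
  by_contra! hne
  have herase : ∀ y ∈ S, (S.erase y).card = 3 := fun y hy => by
    rw [Finset.card_erase_of_mem hy, hS]
  let f : ∀ y ∈ S, {A : Finset V // A.card = 3} := fun y hy => ⟨S.erase y, herase y hy⟩
  have hf : ∀ y hy z hz, y ≠ z → T.tail (f y hy) ≠ T.tail (f z hz) := by
    intro y hy z hz hyz
    refine hne _ _ (fun h => ?_) (Finset.erase_subset _ _) (Finset.erase_subset _ _)
    have h' : S.erase y = S.erase z := congrArg Subtype.val h
    exact Finset.notMem_erase z S (h' ▸ Finset.mem_erase.mpr ⟨hyz.symm, hz⟩)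
  have htail : ∀ y hy, IsTailOf E rank (S.erase y) (T.tail (f y hy)) := fun y hy => hT _
  by_cases h : ∃ a ∈ S, ∃ b ∈ S, E a b
  · obtain ⟨s, hs, hsrc, x, hx, hsx⟩ := hE.exists_source S hS.le h
    have hxs : x ≠ s := by rintro rfl; exact hE.one _ hsx
    have hcard : ((S.erase s).erase x).card = 2 := by
      rw [Finset.card_erase_of_mem (Finset.mem_erase.mpr ⟨hxs, hx⟩), herase s hs]
    obtain ⟨y, z, hyz, hyzS⟩ := Finset.card_eq_two.mp hcard
    have hmem : ∀ v, v ∈ S ↔ v = s ∨ v = x ∨ v = y ∨ v = z := by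
      intro v
      have := Finset.ext_iff.mp hyzS v
      simp only [Finset.mem_erase, Finset.mem_insert, Finset.mem_singleton] at this
      grind
    have hy0 := (Finset.ext_iff.mp hyzS y).mpr (by simp)
    have hz0 := (Finset.ext_iff.mp hyzS z).mpr (by simp)
    simp only [Finset.mem_erase] at hy0 hz0
    obtain ⟨hyx, hys, hy⟩ := hy0
    obtain ⟨hzx, hzs, hz⟩ := hz0
    have t1 := htail s hs
    have t2 := htail x hx
    have t3 := htail y hy
    have t4 := htail z hz
    have e3 : ∃ a ∈ S.erase y, ∃ b ∈ S.erase y, E a b :=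
      ⟨s, by simp [hs, hys.symm], x, by simp [hx, hyx.symm], hsx⟩
    have e4 : ∃ a ∈ S.erase z, ∃ b ∈ S.erase z, E a b :=
      ⟨s, by simp [hs, hzs.symm], x, by simp [hx, hzx.symm], hsx⟩
    -- If the four tails are distinct, each vertex is one of them, and `x` can only be the tail of
    -- `{x, y, z}`. Hence neither `y` nor `z` points to `x`, so both triples containing `s` and `x`
    -- have tail `s`.
    obtain ⟨w3, hw3, hE3⟩ := t3.2.2.1 e3
    obtain ⟨w4, hw4, hE4⟩ := t4.2.2.1 e4
    have m1 := t1.1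
    have m2 := t2.1
    have m3 := t3.1
    have m4 := t4.1
    have s1 := t1.2.1
    have x3 : T.tail (f y hy) ≠ x := fun h =>
      t3.2.1 s (by simp [hs, hys.symm]) (h ▸ hsx)
    have x4 : T.tail (f z hz) ≠ x := fun h =>
      t4.2.1 s (by simp [hs, hzs.symm]) (h ▸ hsx)
    simp only [Finset.mem_erase, hmem] at m1 m2 m3 m4 hw3 hw4 s1
    have hone := hE.one
    grind
  -- Without arcs, the vertex of least rank is the tail of all three triples containing it.
  · obtain ⟨m, hm, hmin⟩ := S.exists_min_image rank (Finset.card_pos.mp (by omega))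
    obtain ⟨y, hy, z, hz, hyz⟩ := Finset.one_lt_card.mp
      (show 1 < (S.erase m).card by rw [herase m hm]; omega)
    rw [Finset.mem_erase] at hy hz
    have key : ∀ y (hy : y ∈ S), y ≠ m → T.tail (f y hy) = m := by
      intro y hy hym
      obtain ⟨h1, -, -, h4⟩ := htail y hy
      refine hrank (le_antisymm (h4 (fun a ha b hb hab => h ⟨a, Finset.mem_of_mem_erase ha, b,
        Finset.mem_of_mem_erase hb, hab⟩) m (Finset.mem_erase.mpr ⟨hym.symm, hm⟩)) ?_)
      exact hmin _ (Finset.mem_of_mem_erase h1)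
    exact hf y hy.2 z hz.2 hyz ((key y hy.2 hy.1).trans (key z hz.2 hz.1).symm)

/-- If at most `k` vertices always have a common in-neighbour, then tails chosen by `IsTailOf`
give a tournament with domination number greater than `k`. -/
theorem lt_dominationNumber_of_isTailOf {V : Type} [Fintype V] {E : V → V → Prop}
    (hE : NoShortCycles E) {rank : V → ℕ} {k : ℕ}
    (hk : ∀ X : Finset V, X.card ≤ k → ∃ v, ∀ x ∈ X, E v x) (T : ThreeTournament V)
    (hT : ∀ A, IsTailOf E rank A.1 (T.tail A)) : k < T.dominationNumber := by
  obtain ⟨X, hX, hcard⟩ := Nat.sInf_mem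
    (⟨_, Finset.univ, T.dominates_univ, rfl⟩ :
      {m : ℕ | ∃ X : Finset V, T.Dominates X ∧ X.card = m}.Nonempty)
  by_contra! hle
  obtain ⟨v, hv⟩ := hk X (hcard.trans_le hle)
  obtain ⟨A, hvA, hAX⟩ := hX v (fun h => hE.one v (hv v h))
  exact (hT A).2.1 v hvA (hv _ hAX)

/-- A colour `p` and four sets of at most `k`, `k ^ 2`, `k ^ 3`, `k ^ 4` colours other than `p`,
to be thought of as the colours met by directed walks of length `1, 2, 3, 4` starting at a vertex
of colour `p`. -/
structure WalkType (k N : ℕ) where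
  p : Fin N
  S : Fin 4 → Finset (Fin N)
  notMem : ∀ i, p ∉ S i
  card_le : ∀ i : Fin 4, (S i).card ≤ k ^ (i.1 + 1)

namespace WalkType

theorem injective_toProd (k N : ℕ) :
    Function.Injective (fun a : WalkType k N => (a.p, a.S)) := by
  rintro ⟨p, S, _, _⟩ ⟨q, R, _, _⟩ h
  simp only [Prod.mk.injEq] at h
  obtain ⟨rfl, rfl⟩ := h
  rfl

noncomputable instance (k N : ℕ) : Fintype (WalkType k N) :=
  Fintype.ofInjective _ (injective_toProd k N)

/-- A vertex of type `a` may have an out-neighbour of type `b`. -/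
def Adj {k N : ℕ} (a b : WalkType k N) : Prop :=
  b.p ∈ a.S 0 ∧ b.S 0 ⊆ a.S 1 ∧ b.S 1 ⊆ a.S 2 ∧ b.S 2 ⊆ a.S 3

/-- A closed walk of length `j` from `a` would put `a.p` in `a.S (j - 1)`. -/
theorem noShortCycles (k N : ℕ) : NoShortCycles (Adj (k := k) (N := N)) where
  one a h := a.notMem 0 h.1
  two a _ h h' := a.notMem 1 (h.2.1 h'.1)
  three a _ _ h h' h'' := a.notMem 2 (h.2.2.1 (h'.2.1 h''.1))
  four a _ _ _ h h' h'' h''' := a.notMem 3 (h.2.2.2 (h'.2.2.1 (h''.2.1 h'''.1)))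

/-- The sets of the new vertex are forced by `X`; with this many colours one is left over for its
own. -/
theorem exists_adj {k N : ℕ} (hN : k + k ^ 2 + k ^ 3 + k ^ 4 < N)
    (X : Finset (WalkType k N)) (hX : X.card ≤ k) : ∃ v, ∀ x ∈ X, Adj v x := by
  classical
  let R : Fin 4 → Finset (Fin N) :=
    ![X.image p, X.biUnion (fun a => a.S 0), X.biUnion (fun a => a.S 1),
      X.biUnion (fun a => a.S 2)]
  have hun : ∀ i : Fin 4, (X.biUnion (fun a => a.S i)).card ≤ k ^ (i.1 + 2) := by
    intro i
    calc _ ≤ X.card * k ^ (i.1 + 1) := Finset.card_biUnion_le_card_mul _ _ _ fun a _ => a.card_le i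
      _ ≤ k * k ^ (i.1 + 1) := Nat.mul_le_mul_right _ hX
      _ = k ^ (i.1 + 2) := by ring
  have hR : ∀ i : Fin 4, (R i).card ≤ k ^ (i.1 + 1) := by
    intro i
    fin_cases i
    · simpa [R] using Finset.card_image_le.trans hX
    · exact hun 0
    · exact hun 1
    · exact hun 2
  obtain ⟨q, hq⟩ : ∃ q, q ∉ Finset.univ.biUnion R := by
    by_contra! hall
    have h1 : N ≤ (Finset.univ.biUnion R).card := by
      rw [Finset.eq_univ_of_forall hall, Finset.card_univ, Fintype.card_fin]
    have h2 : (Finset.univ.biUnion R).card ≤ ∑ i : Fin 4, k ^ (i.1 + 1) :=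
      Finset.card_biUnion_le.trans (Finset.sum_le_sum fun i _ => hR i)
    simp [Fin.sum_univ_four] at h2
    omega
  simp only [Finset.mem_biUnion, Finset.mem_univ, true_and, not_exists] at hq
  refine ⟨⟨q, R, hq, hR⟩, fun x hx => ⟨Finset.mem_image_of_mem p hx, ?_, ?_, ?_⟩⟩
  · exact Finset.subset_biUnion_of_mem (fun a : WalkType k N => a.S 0) hx
  · exact Finset.subset_biUnion_of_mem (fun a : WalkType k N => a.S 1) hx
  · exact Finset.subset_biUnion_of_mem (fun a : WalkType k N => a.S 2) hx

end WalkType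

theorem exists_lt_dominationNumber_and_fourVerticesShareTail (k : ℕ) :
    ∃ (V : Type) (_ : Fintype V) (T : ThreeTournament V),
      k < T.dominationNumber ∧ FourVerticesShareTail T := by
  let V := WalkType k (k + k ^ 2 + k ^ 3 + k ^ 4 + 1)
  have hE : NoShortCycles (WalkType.Adj : V → V → Prop) := WalkType.noShortCycles _ _
  let rank : V → ℕ := fun v => Fintype.equivFin V v
  have hrank : Function.Injective rank := Fin.val_injective.comp (Fintype.equivFin V).injective
  choose t ht using fun A : {A : Finset V // A.card = 3} => hE.exists_isTailOf rank A.1 A.2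
  let T : ThreeTournament V := ⟨t, fun A => (ht A).1⟩
  exact ⟨V, inferInstance, T,
    lt_dominationNumber_of_isTailOf hE (WalkType.exists_adj (Nat.lt_succ_self _)) T ht,
    fourVerticesShareTail_of_isTailOf hE hrank T ht⟩

theorem mainTheorem2 :
    (∀ k : ℕ, ∃ (V : Type) (_ : Fintype V) (T : ThreeTournament V),
      k < T.dominationNumber ∧ FourVerticesShareTail T) ∧
    GyarfasFirstConjecture ∧ ¬ GyarfasSecondConjecture := by
  refine ⟨exists_lt_dominationNumber_and_fourVerticesShareTail, fun k => ?_, ?_⟩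
  · obtain ⟨V, hV, T, hT, -⟩ := exists_lt_dominationNumber_and_fourVerticesShareTail k
    exact ⟨V, hV, T, hT.le⟩
  · rintro ⟨C, hC⟩
    obtain ⟨V, hV, T, hT, hS⟩ := exists_lt_dominationNumber_and_fourVerticesShareTail C
    exact absurd (hC V hV T hS) (not_le.mpr hT)
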